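/- For complex numbers $a,b,c,z$, with $b,c\notin\{0,-1,-2,\dots\}$, let $${}_1F_2(a;b,c;z)=\sum_{n=0}^{\infty}\frac{(a)_n}{(b)_n(c)_n}\frac{z^n}{n!},$$ let $$J_\alpha(z)=\left(\frac z2\right)^{\alpha}\sum_{m=0}^{\infty}\frac{(-1)^m}{m!\,\Gamma(m+\alpha+1)}\left(\frac z2\right)^{2m}$$ be the Bessel function of the first kind, let $(c)_g=\Gamma(c+g)/\Gamma(c)$ be the Pochhammer symbol (so $(c)_n=c(c+1)\cdots(c+n-1)$ for $n\in\mathbb N$), and take principal values of all complex powers. Then for every complex $k\neq 0$ and every complex $\mu\notin\{-1,-2,-3,\dots\}\cup\{\tfrac32,\tfrac12,-\tfrac12,-\tfrac32,\dots\}$, the following series converges absolutely and $$ \begin{aligned} {}_1F_2\!\left(\tfrac{\mu}{2}+\tfrac34;\mu+\tfrac12,\mu+1;-k^2\right) ={}&\frac{2^{\mu-\frac12}\,\Gamma\!\left(\frac{\mu}{2}+\frac14\right)\Gamma(\mu+1)}{\Gamma\!\left(\frac{\mu}{2}-\frac14\right)\Gamma\!\left(\frac{\mu}{2}-\frac34\right)^2}\\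 &\times\sum_{L=0}^{\infty}\frac{(-1)^{2L}\,2^{6L-\frac{3\mu}{2}+\frac94}\,k^{2L-\frac{\mu}{2}+\frac34}\left(\left(\frac{\mu}{2}-\frac14\right)_{2L}\right)^2\Gamma\!\left(2L+\frac{\mu}{2}+\frac14\right)\Gamma\!\left(2L+\mu-\frac32\right)}{(2L)!\left(2L+\frac{\mu}{2}-\frac34\right)\left(L+\frac12\right)_{\mu+\frac12}\left(\left(\mu-\frac32\right)_{2L}\right)^2\left(\left(2L+\mu-\frac32\right)_{2L}\right)^2}\\ &\qquad\times J_{2L+\frac{\mu}{2}-\frac34}(k)\;{}_1F_2\!\left(L+\tfrac12;2L+\tfrac{\mu}{2}+\tfrac14,L+\mu+1;-\tfrac{k^2}{4}\right). \end{aligned} $$ -/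

import Mathlib

/-- The generalized hypergeometric function `₁F₂(a; b, c; z) = ∑ (a)ₙ / ((b)ₙ (c)ₙ) zⁿ / n!`,
where `(x)ₙ = x (x + 1) ⋯ (x + n - 1)` is the rising factorial. -/
noncomputable def hypergeometric1F2 (a b c z : ℂ) : ℂ :=
  ∑' n : ℕ, (ascPochhammer ℂ n).eval a /
    ((ascPochhammer ℂ n).eval b * (ascPochhammer ℂ n).eval c) * (z ^ n / (n.factorial : ℂ))

/-- The Bessel function of the first kind of complex order `ν`,
`J_ν(z) = (z/2)^ν ∑ (-1)ᵐ / (m! Γ(m + ν + 1)) (z/2)^(2m)`, with the principal branch of the power.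
(`Complex.Gamma` is `0` at its poles, so that `1 / Γ` is here the entire reciprocal Gamma
function.) -/
noncomputable def besselFirstKind (ν z : ℂ) : ℂ :=
  (z / 2) ^ ν * ∑' m : ℕ, (-1) ^ m / ((m.factorial : ℂ) * Complex.Gamma ((m : ℂ) + ν + 1)) *
    (z / 2) ^ (2 * m)

/-- The Pochhammer symbol `(c)_g = Γ(c + g) / Γ(c)` with a complex index `g`. -/
noncomputable def pochhammerSymbol (c g : ℂ) : ℂ :=
  Complex.Gamma (c + g) / Complex.Gamma c

/-- The `L`-th term of the series for `₁F₂(μ/2 + 3/4; μ + 1/2, μ + 1; -k²)`. -/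
noncomputable def besselHypergeometricTerm (μ k : ℂ) (L : ℕ) : ℂ :=
  (-1) ^ (2 * L) * (2 : ℂ) ^ (6 * (L : ℂ) - 3 * μ / 2 + 9 / 4)
      * k ^ (2 * (L : ℂ) - μ / 2 + 3 / 4)
      * ((ascPochhammer ℂ (2 * L)).eval (μ / 2 - 1 / 4)) ^ 2
      * Complex.Gamma (2 * (L : ℂ) + μ / 2 + 1 / 4)
      * Complex.Gamma (2 * (L : ℂ) + μ - 3 / 2)
    / (((2 * L).factorial : ℂ) * (2 * (L : ℂ) + μ / 2 - 3 / 4)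
      * pochhammerSymbol ((L : ℂ) + 1 / 2) (μ + 1 / 2)
      * ((ascPochhammer ℂ (2 * L)).eval (μ - 3 / 2)) ^ 2
      * ((ascPochhammer ℂ (2 * L)).eval (2 * (L : ℂ) + μ - 3 / 2)) ^ 2)
    * besselFirstKind (2 * (L : ℂ) + μ / 2 - 3 / 4) k
    * hypergeometric1F2 ((L : ℂ) + 1 / 2) (2 * (L : ℂ) + μ / 2 + 1 / 4) ((L : ℂ) + μ + 1)
        (-k ^ 2 / 4)

/-! Put `μ = 2ν + 3/2`, `k = 2w`, `z = -w²`. In each term the complex powers of `k` and `k/2`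
combine to an integer power, and duplication formulas reduce the Pochhammer and Gamma factors, so
that up to a constant independent of `L` the term is a double power series in `z`, indexed by `i`
(from the Bessel function) and `j` (from the `₁F₂`): `besselHypergeometricTerm_eq`.

The resulting triple series converges absolutely (`summable_tripleTerm`), so it may be regrouped by
`p = L + j`, `q = L + i`, where the power of `z` is `p + q`. For fixed `(p, q)` the sum over `L` is
finite and very-well-poised, with a closed form proved by telescoping (`sum_wellPoisedTerm`). The
remaining sum over `p + q = N` is a Chu–Vandermonde sum (`sum_inv_rising_mul_rising_half`), and one
more duplication turns it into `ν` times the `N`-th term of the `₁F₂` on the left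
(`hasSum_tripleTerm`). Legendre's duplication formula settles the constant (`bessel_prefactor_mul`).
-/

/-! ### Rising factorials and Gamma. -/

/-- The rising factorial `x (x + 1) ⋯ (x + n - 1)`. -/
noncomputable def rising (x : ℂ) (n : ℕ) : ℂ := (ascPochhammer ℂ n).eval x

theorem rising_zero (x : ℂ) : rising x 0 = 1 := by simp [rising]

theorem rising_succ (x : ℂ) (n : ℕ) : rising x (n + 1) = rising x n * (x + n) :=
  ascPochhammer_succ_eval n x

theorem rising_add (x : ℂ) (m n : ℕ) : rising x (m + n) = rising x m * rising (x + m) n := by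
  induction n with
  | zero => simp [rising_zero]
  | succ n ih => rw [← add_assoc, rising_succ, ih, rising_succ]; push_cast; ring

theorem rising_two_mul (x : ℂ) (n : ℕ) :
    rising (2 * x) (2 * n) = 4 ^ n * rising x n * rising (x + 1 / 2) n := by
  induction n with
  | zero => simp [rising_zero]
  | succ n ih =>
    rw [show 2 * (n + 1) = 2 * n + 1 + 1 by ring, rising_succ, rising_succ, ih, rising_succ,
      rising_succ]
    push_cast; ring

theorem rising_ne_zero {x : ℂ} (hx : ∀ n : ℕ, x + n ≠ 0) (n : ℕ) : rising x n ≠ 0 := by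
  induction n with
  | zero => simp [rising_zero]
  | succ n ih => rw [rising_succ]; exact mul_ne_zero ih (hx n)

theorem half_add_natCast_ne_zero (n : ℕ) : (1 / 2 : ℂ) + n ≠ 0 := by
  intro h
  have := congrArg Complex.re h
  simp at this
  have : (0 : ℝ) ≤ n := n.cast_nonneg
  linarith

theorem factorial_two_mul_eq_rising_half (n : ℕ) :
    ((2 * n).factorial : ℂ) = 4 ^ n * rising (1 / 2) n * (n.factorial : ℂ) := by
  induction n with
  | zero => simp [rising_zero]
  | succ n ih =>
    rw [show 2 * (n + 1) = 2 * n + 1 + 1 by ring, Nat.factorial_succ, Nat.factorial_succ,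
      Nat.factorial_succ, rising_succ]
    push_cast
    rw [ih]; ring

theorem Gamma_add_natCast {x : ℂ} (hx : ∀ n : ℕ, x + n ≠ 0) (n : ℕ) :
    Complex.Gamma (x + n) = rising x n * Complex.Gamma x := by
  induction n with
  | zero => simp [rising_zero]
  | succ n ih =>
    rw [Nat.cast_succ, ← add_assoc, Complex.Gamma_add_one _ (hx n), ih, rising_succ]; ring

theorem Gamma_ne_zero_of_add_natCast {x : ℂ} (hx : ∀ n : ℕ, x + n ≠ 0) :
    Complex.Gamma x ≠ 0 :=
  Complex.Gamma_ne_zero fun m h => hx m (by rw [h]; ring)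

/-! ### Growth of rising factorials, up to geometric factors that of `n!`. -/

theorem norm_rising_le (x : ℂ) (n : ℕ) :
    ‖rising x n‖ ≤ (‖x‖ + 1) ^ n * n.factorial := by
  induction n with
  | zero => simp [rising_zero]
  | succ n ih =>
    rw [rising_succ, norm_mul, pow_succ, Nat.factorial_succ]
    have h : ‖x + n‖ ≤ (‖x‖ + 1) * ((n : ℝ) + 1) := by
      refine (norm_add_le _ _).trans ?_
      rw [Complex.norm_natCast]
      nlinarith [norm_nonneg x, n.cast_nonneg (α := ℝ), mul_nonneg (norm_nonneg x)
        (n.cast_nonneg (α := ℝ))]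
    calc _ ≤ ((‖x‖ + 1) ^ n * n.factorial) * ((‖x‖ + 1) * ((n : ℝ) + 1)) := by gcongr
      _ = _ := by push_cast; ring

theorem exists_add_one_le_mul_norm_add {x : ℂ} (hx : ∀ n : ℕ, x + n ≠ 0) :
    ∃ B : ℝ, 1 ≤ B ∧ ∀ n : ℕ, (n : ℝ) + 1 ≤ B * ‖x + n‖ := by
  obtain ⟨N, hN⟩ := exists_nat_ge (2 * ‖x‖ + 1)
  -- The sum covers each of the finitely many `n < N` separately; for `n ≥ N ≥ 2‖x‖ + 1` one has `‖x
  -- + n‖ ≥ (n + 1)/2`, so 4 is ample.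
  refine ⟨4 + ∑ m ∈ Finset.range N, ((m : ℝ) + 1) / ‖x + m‖, ?_, fun n => ?_⟩
  · have : 0 ≤ ∑ m ∈ Finset.range N, ((m : ℝ) + 1) / ‖x + m‖ :=
      Finset.sum_nonneg fun m _ => by positivity
    linarith
  have hpos : 0 < ‖x + n‖ := norm_pos_iff.mpr (hx n)
  have hnn : ∀ m ∈ Finset.range N, 0 ≤ ((m : ℝ) + 1) / ‖x + m‖ := fun m _ => by positivity
  rcases lt_or_ge n N with h | h
  · rw [← div_le_iff₀ hpos]
    have := Finset.single_le_sum hnn (Finset.mem_range.mpr h)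
    linarith
  · have h1 : (N : ℝ) ≤ n := Nat.cast_le.mpr h
    have h2 : (n : ℝ) ≤ ‖x + n‖ + ‖x‖ := by
      have := norm_sub_le (x + n) x
      rwa [add_sub_cancel_left, Complex.norm_natCast] at this
    have h3 := Finset.sum_nonneg hnn
    have h4 := norm_nonneg x
    nlinarith [mul_nonneg h3 hpos.le]

theorem exists_factorial_le_pow_mul_norm_rising {x : ℂ} (hx : ∀ n : ℕ, x + n ≠ 0) :
    ∃ B : ℝ, 1 ≤ B ∧ ∀ n : ℕ, (n.factorial : ℝ) ≤ B ^ n * ‖rising x n‖ := by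
  obtain ⟨B, hB, h⟩ := exists_add_one_le_mul_norm_add hx
  refine ⟨B, hB, fun n => ?_⟩
  induction n with
  | zero => simp [rising_zero]
  | succ n ih =>
    rw [rising_succ, norm_mul, Nat.factorial_succ]
    push_cast
    calc ((n : ℝ) + 1) * n.factorial ≤ (B * ‖x + n‖) * (B ^ n * ‖rising x n‖) := by
          gcongr; exact h n
      _ = _ := by ring

/-! ### The Chu–Vandermonde sum over `p + q = N`. -/

theorem rising_div_factorial_eq_choose (x : ℂ) (n : ℕ) :
    rising x n / n.factorial = Ring.choose (x + n - 1) n := by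
  rw [← Ring.multichoose_eq, div_eq_iff (by exact_mod_cast n.factorial_ne_zero), rising,
    ← Polynomial.ascPochhammer_smeval_eq_eval, ← Ring.factorial_nsmul_multichoose_eq_ascPochhammer,
    nsmul_eq_mul, mul_comm]

/-- On the antidiagonal the factors are the binomials `c + N - 1` over `x.2` and `d + N - 1` over
`x.1`, so this is Vandermonde's convolution. -/
theorem sum_rising_mul_rising (c d : ℂ) (N : ℕ) :
    ∑ x ∈ Finset.HasAntidiagonal.antidiagonal N, (rising (c + x.1) x.2 / x.2.factorial) *
      (rising (d + x.2) x.1 / x.1.factorial) = rising (c + d + N - 1) N / N.factorial := by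
  rw [rising_div_factorial_eq_choose,
    show c + d + N - 1 + N - 1 = (d + N - 1) + (c + N - 1) by ring,
    Ring.add_choose_eq N (Commute.all _ _)]
  refine Finset.sum_congr rfl fun x hx => ?_
  have : (N : ℂ) = x.1 + x.2 := by exact_mod_cast (Finset.HasAntidiagonal.mem_antidiagonal.mp hx).symm
  rw [rising_div_factorial_eq_choose, rising_div_factorial_eq_choose, this, mul_comm,
    show d + (x.2 : ℂ) + x.1 - 1 = d + (x.1 + x.2) - 1 by ring,
    show c + (x.1 : ℂ) + x.2 - 1 = c + (x.1 + x.2) - 1 by ring]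

theorem sum_inv_rising_mul_rising_half {c : ℂ} (hc : ∀ n : ℕ, c + n ≠ 0) (N : ℕ) :
    ∑ x ∈ Finset.HasAntidiagonal.antidiagonal N, rising (1 / 2) x.1 / rising c x.1 /
      (((2 * x.1).factorial : ℂ) * (2 * x.2).factorial) * (2 * N).factorial =
      rising (c - 1 / 2 + N) N / rising c N := by
  have hN := rising_ne_zero hc N
  have key := sum_rising_mul_rising c (1 / 2) N
  rw [show c + 1 / 2 + N - 1 = c - 1 / 2 + N by ring] at key
  have hf : (N.factorial : ℂ) ≠ 0 := by exact_mod_cast N.factorial_ne_zero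
  rw [eq_div_iff hf] at key
  rw [← key, Finset.sum_mul, Finset.sum_div]
  refine Finset.sum_congr rfl fun x hx => ?_
  obtain ⟨p, q⟩ := x
  have h := (Finset.HasAntidiagonal.mem_antidiagonal.mp hx)
  simp only at h ⊢
  have e1 : rising c N = rising c p * rising (c + p) q := by rw [← h, rising_add]
  have e2 : rising (1 / 2) N = rising (1 / 2) q * rising (1 / 2 + q) p := by
    rw [← h, add_comm, rising_add]
  have hp : (p.factorial : ℂ) ≠ 0 := by exact_mod_cast p.factorial_ne_zero
  have hq : (q.factorial : ℂ) ≠ 0 := by exact_mod_cast q.factorial_ne_zero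
  have h1 := rising_ne_zero half_add_natCast_ne_zero p
  have h2 := rising_ne_zero half_add_natCast_ne_zero q
  have h3 := rising_ne_zero hc p
  have h4 : rising (c + p) q ≠ 0 := fun h0 => hN (by rw [e1, h0, mul_zero])
  rw [factorial_two_mul_eq_rising_half p, factorial_two_mul_eq_rising_half q, factorial_two_mul_eq_rising_half N, e1, e2, ← h, pow_add]
  field_simp

/-! ### The terminating very-well-poised sum. -/

/-- The summand, up to its very-well-poised factor `ν + 2 L`, of the terminating `₅F₄` series
that gives the coefficients in the addition theorem for `J_ν`. -/
noncomputable def wellPoisedTerm (ν : ℂ) (p q L : ℕ) : ℂ :=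
  rising (2 * ν) (2 * L) / (2 * L).factorial * p.descFactorial L * q.descFactorial L /
    (rising (ν + 1) (p + L) * rising (ν + 1) (q + L))

theorem natCast_descFactorial_succ (n k : ℕ) :
    ((n.descFactorial (k + 1) : ℕ) : ℂ) = ((n : ℂ) - k) * n.descFactorial k := by
  rcases le_or_gt k n with h | h
  · rw [Nat.descFactorial_succ]; push_cast [h]; ring
  · rw [Nat.descFactorial_of_lt h, Nat.descFactorial_of_lt (by omega)]; simp

theorem natCast_succ_descFactorial (n k : ℕ) :
    ((n : ℂ) + 1 - k) * ((n + 1).descFactorial k : ℕ) = ((n : ℂ) + 1) * n.descFactorial k := by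
  have h := Nat.succ_descFactorial n k
  rcases le_or_gt k (n + 1) with hk | hk
  · have := congrArg (Nat.cast (R := ℂ)) h
    push_cast [hk] at this
    exact this
  · rw [Nat.descFactorial_of_lt hk, Nat.descFactorial_of_lt (by omega)]; simp

theorem wellPoisedTerm_succ {ν : ℂ} (hν : ∀ n : ℕ, ν + 1 + n ≠ 0) (p q L : ℕ) :
    (L + 1) * (2 * L + 1) * (ν + 1 + (p + L)) * (ν + 1 + (q + L)) * wellPoisedTerm ν p q (L + 1) =
      (ν + L) * (2 * ν + 2 * L + 1) * (p - L) * (q - L) * wellPoisedTerm ν p q L := by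
  have h1 := rising_ne_zero hν (p + L)
  have h2 := rising_ne_zero hν (q + L)
  have h3 := hν (p + L)
  have h4 := hν (q + L)
  have h5 : ((2 * L).factorial : ℂ) ≠ 0 := by exact_mod_cast (2 * L).factorial_ne_zero
  have h6 : (L : ℂ) * 2 + 1 ≠ 0 := by exact_mod_cast (L * 2).succ_ne_zero
  have h7 : ((L : ℂ) + 1) ≠ 0 := by exact_mod_cast L.succ_ne_zero
  push_cast at h3 h4
  rw [wellPoisedTerm, wellPoisedTerm, show 2 * (L + 1) = 2 * L + 1 + 1 by ring,
    natCast_descFactorial_succ, natCast_descFactorial_succ, ← add_assoc p, ← add_assoc q,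
    rising_succ _ (p + L), rising_succ _ (q + L), rising_succ, rising_succ, Nat.factorial_succ,
    Nat.factorial_succ]
  push_cast
  rw [show 2 * (L : ℂ) + 1 + 1 = 2 * (L + 1) by ring]
  field_simp
  ring

/-- Contiguity in `q`, cross-multiplied so that it also holds at `L = q + 1`, where both sides
vanish. -/
theorem wellPoisedTerm_right {ν : ℂ} (hν : ∀ n : ℕ, ν + 1 + n ≠ 0) (p q L : ℕ) :
    (q + 1) * wellPoisedTerm ν p q L =
      (q + 1 - L) * (ν + 1 + (q + L)) * wellPoisedTerm ν p (q + 1) L := by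
  have h1 := rising_ne_zero hν (p + L)
  have h2 := rising_ne_zero hν (q + L)
  have h4 := hν (q + L)
  have h5 : ((2 * L).factorial : ℂ) ≠ 0 := by exact_mod_cast (2 * L).factorial_ne_zero
  have h6 := natCast_succ_descFactorial q L
  push_cast at h4
  rw [wellPoisedTerm, wellPoisedTerm, show q + 1 + L = q + L + 1 by ring, rising_succ]
  push_cast
  field_simp
  linear_combination -(p.descFactorial L : ℂ) * rising (2 * ν) (2 * L) * h6

theorem wellPoisedTerm_eq_zero (ν : ℂ) (p : ℕ) {q L : ℕ} (h : q < L) :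
    wellPoisedTerm ν p q L = 0 := by
  simp [wellPoisedTerm, Nat.descFactorial_of_lt h]

theorem sum_wellPoisedTerm_succ {ν : ℂ} (hν : ∀ n : ℕ, ν + 1 + n ≠ 0) (p q : ℕ) :
    (2 * q + 1) * (ν + 1 + (p + q)) *
        ∑ L ∈ Finset.range (q + 2), (ν + 2 * L) * wellPoisedTerm ν p (q + 1) L =
      (2 * p + 2 * q + 1) * ∑ L ∈ Finset.range (q + 1), (ν + 2 * L) * wellPoisedTerm ν p q L := by
  have e : ∑ L ∈ Finset.range (q + 1), (ν + 2 * L) * wellPoisedTerm ν p q L =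
      ∑ L ∈ Finset.range (q + 2), (ν + 2 * L) * wellPoisedTerm ν p q L := by
    rw [Finset.sum_range_succ _ (q + 1), wellPoisedTerm_eq_zero ν p q.lt_succ_self]; simp
  have hq : (q : ℂ) + 1 ≠ 0 := by exact_mod_cast q.succ_ne_zero
  -- Zeilberger certificate for the recurrence in `q`: it vanishes at `L = 0` through the factor
  -- `L`, and at `L = q + 2` because the falling factorial of `q + 1` does.
  set G : ℕ → ℂ := fun L => -(L * (2 * L - 1) * (ν + p + L) * (ν + q + 1 + L)) *
    wellPoisedTerm ν p (q + 1) L with hG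
  have step : ∀ L : ℕ, (q + 1) * ((2 * q + 1) * (ν + 1 + (p + q)) *
      ((ν + 2 * L) * wellPoisedTerm ν p (q + 1) L) -
      (2 * p + 2 * q + 1) * ((ν + 2 * L) * wellPoisedTerm ν p q L)) = G (L + 1) - G L := by
    intro L
    have h1 := wellPoisedTerm_succ hν p (q + 1) L
    have h2 := wellPoisedTerm_right hν p q L
    simp only [hG]
    push_cast at h1 ⊢
    linear_combination h1 - (2 * p + 2 * q + 1) * (ν + 2 * L) * h2
  have tele := Finset.sum_range_sub G (q + 2)
  rw [← Finset.sum_congr rfl fun L _ => step L, ← Finset.mul_sum, Finset.sum_sub_distrib,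
    ← Finset.mul_sum, ← Finset.mul_sum, ← e] at tele
  have h0 : G (q + 2) - G 0 = 0 := by
    simp [hG, wellPoisedTerm_eq_zero ν p (show q + 1 < q + 2 by omega)]
  rw [h0] at tele
  exact sub_eq_zero.mp ((mul_eq_zero.mp tele).resolve_left hq)

theorem sum_wellPoisedTerm {ν : ℂ} (hν : ∀ n : ℕ, ν + 1 + n ≠ 0) (p q : ℕ) :
    ∑ L ∈ Finset.range (q + 1), (ν + 2 * L) * wellPoisedTerm ν p q L =
      ν * p.factorial * q.factorial * (2 * (p + q)).factorial /
        (rising (ν + 1) (p + q) * (p + q).factorial * (2 * p).factorial * (2 * q).factorial) := by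
  induction q with
  | zero =>
    have h1 := rising_ne_zero hν p
    have h2 : ((2 * p).factorial : ℂ) ≠ 0 := by exact_mod_cast (2 * p).factorial_ne_zero
    have h3 : (p.factorial : ℂ) ≠ 0 := by exact_mod_cast p.factorial_ne_zero
    simp [wellPoisedTerm, rising_zero]
    field_simp
  | succ q ih =>
    have h := sum_wellPoisedTerm_succ hν p q
    have h1 := rising_ne_zero hν (p + q)
    have h2 : ((2 * p).factorial : ℂ) ≠ 0 := by exact_mod_cast (2 * p).factorial_ne_zero
    have h3 : ((2 * q).factorial : ℂ) ≠ 0 := by exact_mod_cast (2 * q).factorial_ne_zero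
    have h4 : ((p + q).factorial : ℂ) ≠ 0 := by exact_mod_cast (p + q).factorial_ne_zero
    have h5 := hν (p + q)
    have h6 : (2 * (q : ℂ) + 1) ≠ 0 := by exact_mod_cast (2 * q).succ_ne_zero
    have h7 : (p : ℂ) + q + 1 ≠ 0 := by exact_mod_cast (p + q).succ_ne_zero
    have h8 : (q : ℂ) + 1 ≠ 0 := by exact_mod_cast q.succ_ne_zero
    push_cast at h5
    rw [ih] at h
    rw [← mul_right_inj' (mul_ne_zero h6 h5), h, ← add_assoc p,
      show 2 * (p + q + 1) = 2 * (p + q) + 1 + 1 by ring,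
      show 2 * (q + 1) = 2 * q + 1 + 1 by ring, rising_succ]
    simp only [Nat.factorial_succ]
    push_cast
    rw [show 2 * (q : ℂ) + 1 + 1 = 2 * (q + 1) by ring]
    field_simp
    ring

/-! ### Absolute convergence of the triple series. -/

/-- The triple series obtained by expanding both factors of every term of the series in products
of a Bessel function `J_{ν + 2 L}` and a function `₁F₂`. -/
noncomputable def tripleTerm (ν c z : ℂ) (x : ℕ × ℕ × ℕ) : ℂ :=
  (ν + 2 * x.1) * (rising (2 * ν) (2 * x.1) / (2 * x.1).factorial) * z ^ (2 * x.1) *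
    ((z ^ x.2.1 / (x.2.1.factorial * rising (ν + 1) (2 * x.1 + x.2.1))) *
      (rising (1 / 2) (x.1 + x.2.2) / rising c (x.1 + x.2.2) /
        rising (ν + 1) (2 * x.1 + x.2.2) * (z ^ x.2.2 / x.2.2.factorial)))

theorem exists_norm_inv_rising_le {x : ℂ} (hx : ∀ n : ℕ, x + n ≠ 0) :
    ∃ B : ℝ, 1 ≤ B ∧ ∀ n : ℕ, ‖rising x n‖⁻¹ ≤ B ^ n / n.factorial := by
  obtain ⟨B, hB, h⟩ := exists_factorial_le_pow_mul_norm_rising hx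
  refine ⟨B, hB, fun n => ?_⟩
  have h1 : 0 < ‖rising x n‖ := norm_pos_iff.mpr (rising_ne_zero hx n)
  have h2 : (0 : ℝ) < n.factorial := by exact_mod_cast n.factorial_pos
  rw [inv_eq_one_div, div_le_div_iff₀ h1 h2, one_mul]
  exact h n

theorem exists_norm_rising_div_rising_le (x : ℂ) {y : ℂ} (hy : ∀ n : ℕ, y + n ≠ 0) :
    ∃ R : ℝ, 0 ≤ R ∧ ∀ n : ℕ, ‖rising x n / rising y n‖ ≤ R ^ n := by
  obtain ⟨B, hB, h⟩ := exists_norm_inv_rising_le hy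
  refine ⟨(‖x‖ + 1) * B, by positivity, fun n => ?_⟩
  have h2 : (n.factorial : ℝ) ≠ 0 := by exact_mod_cast n.factorial_ne_zero
  rw [norm_div, div_eq_mul_inv]
  calc _ ≤ ((‖x‖ + 1) ^ n * n.factorial) * (B ^ n / n.factorial) := by
        gcongr
        · exact norm_rising_le x n
        · exact h n
    _ = _ := by rw [mul_pow]; field_simp

theorem norm_add_two_mul_natCast_le (x : ℂ) (n : ℕ) : ‖x + 2 * n‖ ≤ (‖x‖ + 1) * 4 ^ n := by
  have h1 : ((2 * n : ℕ) : ℝ) ≤ 2 ^ (2 * n) := by exact_mod_cast Nat.lt_two_pow_self.le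
  have h2 : (1 : ℝ) ≤ 4 ^ n := one_le_pow₀ (by norm_num)
  have h3 : ‖x + 2 * n‖ ≤ ‖x‖ + 2 * n := by
    refine (norm_add_le _ _).trans ?_
    simp
  rw [pow_mul, show (2 : ℝ) ^ 2 = 4 by norm_num] at h1
  push_cast at h1
  nlinarith [norm_nonneg x, mul_nonneg (norm_nonneg x) (sub_nonneg.mpr h2)]

theorem summable_pow_div_factorial_prod (a b d : ℝ) (ha : 0 ≤ a) (hb : 0 ≤ b) (hd : 0 ≤ d) :
    Summable fun x : ℕ × ℕ × ℕ => a ^ x.1 / x.1.factorial *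
      (b ^ x.2.1 / x.2.1.factorial * (d ^ x.2.2 / x.2.2.factorial)) :=
  (Real.summable_pow_div_factorial a).mul_of_nonneg
    ((Real.summable_pow_div_factorial b).mul_of_nonneg (Real.summable_pow_div_factorial d)
      (fun _ => by positivity) (fun _ => by positivity))
    (fun _ => by positivity) (fun _ => by positivity)

theorem mul_mul_le_mul_mul_of_nonneg {a a' b b' u u' r r' v v' s d e : ℝ} (ha : 0 ≤ a) (hb : 0 ≤ b)
    (hs : 0 ≤ s) (hd : 0 ≤ d) (hu : 0 ≤ u) (hr : 0 ≤ r) (hv : 0 ≤ v) (he : 0 ≤ e) (h1 : a ≤ a')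
    (h2 : b ≤ b') (h3 : u ≤ u') (h4 : r ≤ r') (h5 : v ≤ v') :
    a * b * s * ((d * u) * (r * v * e)) ≤ a' * b' * s * ((d * u') * (r' * v' * e)) := by
  have := ha.trans h1
  have := hb.trans h2
  have := hu.trans h3
  have := hr.trans h4
  gcongr

theorem norm_tripleTerm (ν c z : ℂ) (L i j : ℕ) : ‖tripleTerm ν c z (L, i, j)‖ =
    ‖ν + 2 * L‖ * ‖rising (2 * ν) (2 * L) / (2 * L).factorial‖ * ‖z‖ ^ (2 * L) *
      ((‖z‖ ^ i / i.factorial * ‖rising (ν + 1) (2 * L + i)‖⁻¹) *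
      (‖rising (1 / 2) (L + j) / rising c (L + j)‖ * ‖rising (ν + 1) (2 * L + j)‖⁻¹ *
        (‖z‖ ^ j / j.factorial))) := by
  dsimp only [tripleTerm]
  generalize rising (2 * ν) (2 * L) / ((2 * L).factorial : ℂ) = w
  generalize rising (1 / 2) (L + j) / rising c (L + j) = t
  rw [norm_mul, norm_mul, norm_mul, norm_mul, norm_mul, norm_div, norm_mul, norm_div t, norm_div,
    norm_pow, norm_pow, norm_pow, Complex.norm_natCast, Complex.norm_natCast,
    div_mul_eq_div_mul_one_div, one_div, div_eq_mul_inv ‖t‖]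

theorem summable_tripleTerm {ν c : ℂ} (hν : ∀ n : ℕ, ν + 1 + n ≠ 0) (hc : ∀ n : ℕ, c + n ≠ 0)
    (z : ℂ) : Summable (tripleTerm ν c z) := by
  obtain ⟨B, hB, h1⟩ := exists_norm_inv_rising_le hν
  obtain ⟨R, hR, h2⟩ := exists_norm_rising_div_rising_le (1 / 2) hc
  have hB0 : 0 ≤ B := zero_le_one.trans hB
  set A := ‖2 * ν‖ + 1 with hA
  have hA0 : 0 ≤ A := by positivity
  have hfac : ∀ n : ℕ, (0 : ℝ) < n.factorial := fun n => by exact_mod_cast n.factorial_pos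
  refine Summable.of_norm_bounded
    ((summable_pow_div_factorial_prod (4 * A ^ 2 * ‖z‖ ^ 2 * B ^ 2 * R * B ^ 2) (‖z‖ * B)
      (R * B * ‖z‖) (by positivity) (by positivity) (by positivity)).mul_left (‖ν‖ + 1)) ?_
  rintro ⟨L, i, j⟩
  have e1 : ‖rising (2 * ν) (2 * L) / (2 * L).factorial‖ ≤ A ^ (2 * L) := by
    rw [norm_div, Complex.norm_natCast, div_le_iff₀ (hfac _)]
    exact norm_rising_le _ _
  -- The single `1 / L!` kept here beats all the geometric growth in `L`; the factorial in `e3` can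
  -- be discarded, since `i` and `j` have their own.
  have e2 : ‖rising (ν + 1) (2 * L + i)‖⁻¹ ≤ B ^ (2 * L + i) / L.factorial := by
    refine (h1 _).trans ?_
    gcongr
    omega
  have e3 : ‖rising (ν + 1) (2 * L + j)‖⁻¹ ≤ B ^ (2 * L + j) := by
    refine (h1 _).trans (div_le_self (by positivity) ?_)
    exact_mod_cast Nat.one_le_iff_ne_zero.mpr (Nat.factorial_ne_zero _)
  rw [norm_tripleTerm]
  calc _
    _ ≤ ((‖ν‖ + 1) * 4 ^ L) * A ^ (2 * L) * ‖z‖ ^ (2 * L) *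
        ((‖z‖ ^ i / i.factorial * (B ^ (2 * L + i) / L.factorial)) *
        (R ^ (L + j) * B ^ (2 * L + j) * (‖z‖ ^ j / j.factorial))) := by
        exact mul_mul_le_mul_mul_of_nonneg (norm_nonneg _) (norm_nonneg _) (by positivity) (by positivity) (by positivity)
          (norm_nonneg _) (by positivity) (by positivity) (norm_add_two_mul_natCast_le ν L) e1 e2
          (h2 _) e3
    _ = (‖ν‖ + 1) * ((4 * A ^ 2 * ‖z‖ ^ 2 * B ^ 2 * R * B ^ 2) ^ L / L.factorial *
          ((‖z‖ * B) ^ i / i.factorial * ((R * B * ‖z‖) ^ j / j.factorial))) := by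
        simp only [mul_pow, pow_add, pow_mul, div_eq_mul_inv]
        ring

/-! ### Regrouping the triple series by `p = L + j`, `q = L + i`. -/

theorem tripleTerm_eq {ν c z : ℂ} {p q L : ℕ} (hp : L ≤ p) (hq : L ≤ q) :
    tripleTerm ν c z (L, q - L, p - L) = (ν + 2 * L) * wellPoisedTerm ν p q L *
      (z ^ (p + q) * (rising (1 / 2) p / rising c p) / (p.factorial * q.factorial)) := by
  obtain ⟨j, rfl⟩ := Nat.exists_eq_add_of_le hp
  obtain ⟨i, rfl⟩ := Nat.exists_eq_add_of_le hq
  have hfac : ∀ n : ℕ, (n.factorial : ℂ) ≠ 0 := fun n => by exact_mod_cast n.factorial_ne_zero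
  have e : ∀ n : ℕ, (((L + n).descFactorial L : ℕ) : ℂ) = (L + n).factorial / n.factorial := by
    intro n
    have h := Nat.factorial_mul_descFactorial (Nat.le_add_right L n)
    rw [Nat.add_sub_cancel_left] at h
    rw [eq_div_iff (hfac n), mul_comm]
    exact_mod_cast h
  have h1 := hfac (L + i)
  have h2 := hfac (L + j)
  simp only [tripleTerm, wellPoisedTerm, e, Nat.add_sub_cancel_left]
  rw [show 2 * L + i = L + i + L by ring, show 2 * L + j = L + j + L by ring,
    show L + j + (L + i) = 2 * L + i + j by ring, pow_add, pow_add]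
  generalize ((L + i).factorial : ℂ) = a at h1 ⊢
  generalize ((L + j).factorial : ℂ) = b at h2 ⊢
  generalize rising (1 / 2) (L + j) / rising c (L + j) = t
  generalize rising (ν + 1) (L + i + L) = u
  generalize rising (ν + 1) (L + j + L) = v
  generalize rising (2 * ν) (2 * L) / ((2 * L).factorial : ℂ) = w
  simp only [div_eq_mul_inv, mul_inv]
  linear_combination (-(ν + 2 * L) * w * z ^ (2 * L) * z ^ i * z ^ j * (i.factorial : ℂ)⁻¹ *
    (j.factorial : ℂ)⁻¹ * t * u⁻¹ * v⁻¹) * ((a * a⁻¹) * mul_inv_cancel₀ h2 + mul_inv_cancel₀ h1)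

theorem preimage_add_prod_eq (p q : ℕ) :
    (fun x : ℕ × ℕ × ℕ => (x.1 + x.2.2, x.1 + x.2.1)) ⁻¹' {(p, q)} =
      (((Finset.range (q + 1)).filter (· ≤ p)).image fun L => (L, q - L, p - L) : Finset _) := by
  ext ⟨L, i, j⟩
  simp only [Set.mem_preimage, Set.mem_singleton_iff, Prod.mk.injEq, Finset.coe_image,
    Finset.coe_filter, Finset.mem_range, Set.mem_image, Set.mem_ofPred_eq]
  constructor
  · rintro ⟨h1, h2⟩
    exact ⟨L, ⟨by omega, by omega⟩, rfl, by omega, by omega⟩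
  · rintro ⟨L', ⟨h1, h2⟩, rfl, h3, h4⟩
    exact ⟨by omega, by omega⟩

theorem tsum_fiber_tripleTerm {ν : ℂ} (hν : ∀ n : ℕ, ν + 1 + n ≠ 0) (c z : ℂ) (p q : ℕ) :
    ∑' x : (fun x : ℕ × ℕ × ℕ => (x.1 + x.2.2, x.1 + x.2.1)) ⁻¹' {(p, q)}, tripleTerm ν c z x =
      ν * z ^ (p + q) / (rising (ν + 1) (p + q) * (p + q).factorial) *
        (rising (1 / 2) p / rising c p / (((2 * p).factorial : ℂ) * (2 * q).factorial) *
          (2 * (p + q)).factorial) := by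
  have hfac : ∀ n : ℕ, (n.factorial : ℂ) ≠ 0 := fun n => by exact_mod_cast n.factorial_ne_zero
  rw [preimage_add_prod_eq, Finset.tsum_subtype' _ (tripleTerm ν c z), Finset.sum_image]
  · rw [Finset.sum_congr rfl fun L hL => tripleTerm_eq (ν := ν) (c := c) (z := z)
      (Finset.mem_filter.mp hL).2 (Nat.lt_succ_iff.mp (Finset.mem_range.mp
        (Finset.mem_filter.mp hL).1)), ← Finset.sum_mul, Finset.sum_filter_of_ne,
      sum_wellPoisedTerm hν]
    · have h1 := hfac p
      have h2 := hfac q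
      field_simp
    · intro L _ h
      by_contra hL
      exact h (by simp [wellPoisedTerm, Nat.descFactorial_of_lt (not_le.mp hL)])
  · intro a _ b _ h
    exact (Prod.mk.inj h).1

theorem hasSum_tripleTerm {ν : ℂ} (hν : ∀ n : ℕ, ν + n ≠ 0) (hν' : ∀ n : ℕ, 2 * ν + 1 + n ≠ 0)
    (hc : ∀ n : ℕ, 2 * ν + 5 / 2 + n ≠ 0) (z : ℂ) :
    HasSum (fun N : ℕ => ν * (rising (ν + 3 / 2) N / (rising (2 * ν + 2) N *
      rising (2 * ν + 5 / 2) N) * ((4 * z) ^ N / N.factorial)))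
      (∑' x, tripleTerm ν (2 * ν + 5 / 2) z x) := by
  have hν1 : ∀ n : ℕ, ν + 1 + n ≠ 0 := fun n => by
    have := hν (n + 1); push_cast at this; rwa [add_assoc, add_comm 1 (n : ℂ)]
  -- Two regroupings: first by `(p, q)`, then by `N = p + q`.
  have h := ((summable_tripleTerm hν1 hc z).hasSum.tsum_fiberwise
    fun x : ℕ × ℕ × ℕ => (x.1 + x.2.2, x.1 + x.2.1)).tsum_fiberwise fun x : ℕ × ℕ => x.1 + x.2
  refine HasSum.congr_fun h fun N => ?_
  have e : (fun x : ℕ × ℕ => x.1 + x.2) ⁻¹' {N} =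
      (Finset.HasAntidiagonal.antidiagonal N : Finset (ℕ × ℕ)) := by
    ext x; simp
  rw [e, Finset.tsum_subtype' _ fun y : ℕ × ℕ => ∑' x : (fun x : ℕ × ℕ × ℕ =>
    (x.1 + x.2.2, x.1 + x.2.1)) ⁻¹' {y}, tripleTerm ν (2 * ν + 5 / 2) z x]
  have e2 : ∀ y ∈ Finset.HasAntidiagonal.antidiagonal N, (∑' x : (fun x : ℕ × ℕ × ℕ =>
      (x.1 + x.2.2, x.1 + x.2.1)) ⁻¹' {y}, tripleTerm ν (2 * ν + 5 / 2) z x) =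
      ν * z ^ N / (rising (ν + 1) N * N.factorial) *
        (rising (1 / 2) y.1 / rising (2 * ν + 5 / 2) y.1 /
          (((2 * y.1).factorial : ℂ) * (2 * y.2).factorial) * (2 * N).factorial) := by
    rintro ⟨p, q⟩ hy
    rw [tsum_fiber_tripleTerm hν1, Finset.HasAntidiagonal.mem_antidiagonal.mp hy]
  rw [Finset.sum_congr rfl e2, ← Finset.mul_sum, sum_inv_rising_mul_rising_half hc]
  have h22 : ∀ n : ℕ, 2 * ν + 2 + n ≠ 0 := fun n => by
    have := hν' (n + 1)
    push_cast at this
    rwa [show 2 * ν + 2 + (n : ℂ) = 2 * ν + 1 + (n + 1) by ring]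
  have h1 := rising_ne_zero hν1 N
  have h2 := rising_ne_zero h22 N
  have h3 := rising_ne_zero hc N
  have h4 : (N.factorial : ℂ) ≠ 0 := by exact_mod_cast N.factorial_ne_zero
  -- The choice `c = 2ν + 5/2` makes the Vandermonde value `(2ν + 2 + N)_N`, the upper half of `(2ν
  -- + 2)_{2N}`; duplication then cancels `(ν + 1)_N` and leaves `(ν + 3/2)_N`.
  have h5 := rising_two_mul (ν + 1) N
  rw [show 2 * (ν + 1) = 2 * ν + 2 by ring, two_mul N, rising_add,
    show ν + 1 + 1 / 2 = ν + 3 / 2 by ring] at h5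
  rw [show 2 * ν + 5 / 2 - 1 / 2 + (N : ℂ) = 2 * ν + 2 + N by ring, mul_pow]
  generalize rising (2 * ν + 2) N = a at h2 h5 ⊢
  generalize rising (2 * ν + 2 + N) N = b at h5 ⊢
  generalize rising (2 * ν + 5 / 2) N = d at h3 ⊢
  generalize rising (ν + 1) N = r at h1 h5 ⊢
  generalize rising (ν + 3 / 2) N = t at h5 ⊢
  field_simp
  linear_combination -(ν * z ^ N) * h5

/-! ### Reduction of the Bessel terms to the triple series. -/

/-- Since 2 is a positive real, it splits off the principal power without a branch correction. -/
theorem two_mul_cpow {w : ℂ} (hw : w ≠ 0) (s : ℂ) : (2 * w) ^ s = 2 ^ s * w ^ s := by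
  have h := Complex.log_ofReal_mul (r := 2) two_pos hw
  rw [Complex.ofReal_log zero_le_two, Complex.ofReal_ofNat] at h
  rw [Complex.cpow_def_of_ne_zero (mul_ne_zero two_ne_zero hw),
    Complex.cpow_def_of_ne_zero two_ne_zero, Complex.cpow_def_of_ne_zero hw, h, add_mul,
    Complex.exp_add]

theorem besselFirstKind_two_mul {ν : ℂ} (hν : ∀ n : ℕ, ν + 1 + n ≠ 0) (w : ℂ) (L : ℕ) :
    besselFirstKind (2 * L + ν) (2 * w) = w ^ (2 * L + ν) / Complex.Gamma (ν + 1) *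
      ∑' i : ℕ, (-w ^ 2) ^ i / (i.factorial * rising (ν + 1) (2 * L + i)) := by
  rw [besselFirstKind, mul_div_cancel_left₀ w two_ne_zero, div_mul_eq_mul_div, mul_div_assoc,
    ← tsum_div_const]
  congr 1
  refine tsum_congr fun i => ?_
  rw [show (i : ℂ) + (2 * L + ν) + 1 = ν + 1 + (2 * L + i : ℕ) by push_cast; ring,
    Gamma_add_natCast hν, neg_pow (w ^ 2), ← pow_mul]
  simp only [div_eq_mul_inv, mul_inv]
  ring

theorem hypergeometric1F2_add_natCast {ν c : ℂ} (hν : ∀ n : ℕ, ν + 1 + n ≠ 0)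
    (hc : ∀ n : ℕ, c + n ≠ 0) (z : ℂ) (L : ℕ) :
    hypergeometric1F2 (L + 1 / 2) (2 * L + ν + 1) (L + c) z =
      rising (ν + 1) (2 * L) * rising c L / rising (1 / 2) L *
        ∑' j : ℕ, rising (1 / 2) (L + j) / rising c (L + j) / rising (ν + 1) (2 * L + j) *
          (z ^ j / j.factorial) := by
  rw [hypergeometric1F2, ← tsum_mul_left]
  refine tsum_congr fun j => ?_
  have h1 := rising_ne_zero hν (2 * L)
  have h2 := rising_ne_zero hc L
  have h3 := rising_ne_zero half_add_natCast_ne_zero L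
  rw [show (2 * L : ℂ) + ν + 1 = ν + 1 + (2 * L : ℕ) by push_cast; ring, add_comm (L : ℂ),
    add_comm (L : ℂ), rising_add, rising_add, rising_add]
  simp only [rising] at h1 h2 h3 ⊢
  simp only [div_eq_mul_inv, mul_inv]
  field_simp

theorem besselHypergeometricTerm_eq {ν : ℂ} (hν : ∀ n : ℕ, 2 * ν + n ≠ 0)
    (hc : ∀ n : ℕ, 2 * ν + 5 / 2 + n ≠ 0) {w : ℂ} (hw : w ≠ 0) (L : ℕ) :
    besselHypergeometricTerm (2 * ν + 3 / 2) (2 * w) L =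
      (2 : ℂ) ^ (-4 * ν) * Complex.Gamma (2 * ν) * Complex.Gamma (1 / 2) /
        (Complex.Gamma (2 * ν + 5 / 2) * ν ^ 2) *
        ((ν + 2 * L) * (rising (2 * ν) (2 * L) / (2 * L).factorial) * (-w ^ 2) ^ (2 * L) *
          ((∑' i : ℕ, (-w ^ 2) ^ i / (i.factorial * rising (ν + 1) (2 * L + i))) *
            ∑' j : ℕ, rising (1 / 2) (L + j) / rising (2 * ν + 5 / 2) (L + j) /
              rising (ν + 1) (2 * L + j) * ((-w ^ 2) ^ j / j.factorial))) := by
  have hν0 : ∀ n : ℕ, ν + n ≠ 0 := fun n h => hν (2 * n) (by push_cast; linear_combination 2 * h)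
  have hν1 : ∀ n : ℕ, ν + 1 + n ≠ 0 := fun n h =>
    hν0 (n + 1) (by push_cast; linear_combination h)
  have hνh : ∀ n : ℕ, ν + 1 / 2 + n ≠ 0 := fun n h =>
    hν (2 * n + 1) (by push_cast; linear_combination 2 * h)
  rw [besselHypergeometricTerm, pochhammerSymbol,
    show (2 * (L : ℂ) + (2 * ν + 3 / 2) / 2 - 3 / 4) = 2 * L + ν by ring,
    show (2 * (L : ℂ) + (2 * ν + 3 / 2) / 2 + 1 / 4) = 2 * L + ν + 1 by ring,
    show (L : ℂ) + (2 * ν + 3 / 2) + 1 = L + (2 * ν + 5 / 2) by ring,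
    show -(2 * w) ^ 2 / 4 = -w ^ 2 by ring,
    show 6 * (L : ℂ) - 3 * (2 * ν + 3 / 2) / 2 + 9 / 4 = 6 * L - 3 * ν by ring,
    show 2 * (L : ℂ) - (2 * ν + 3 / 2) / 2 + 3 / 4 = 2 * L - ν by ring,
    show (2 * ν + 3 / 2) / 2 - 1 / 4 = ν + 1 / 2 by ring,
    show 2 * (L : ℂ) + (2 * ν + 3 / 2) - 3 / 2 = 2 * ν + (2 * L : ℕ) by push_cast; ring,
    show 2 * ν + 3 / 2 - 3 / 2 = 2 * ν by ring,
    show (L : ℂ) + 1 / 2 + (2 * ν + 3 / 2 + 1 / 2) = 2 * ν + 5 / 2 + L by ring,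
    besselFirstKind_two_mul hν1, hypergeometric1F2_add_natCast hν1 hc, two_mul_cpow hw,
    show (2 * L : ℂ) + ν + 1 = ν + 1 + (2 * L : ℕ) by push_cast; ring, Gamma_add_natCast hν1,
    Gamma_add_natCast hν, Gamma_add_natCast hc, add_comm (L : ℂ) (1 / 2),
    Gamma_add_natCast half_add_natCast_ne_zero, pow_mul (-1 : ℂ) 2, neg_one_sq, one_pow, one_mul]
  change _ * rising (ν + 1 / 2) (2 * L) ^ 2 * _ * _ / (_ * _ * _ * rising (2 * ν) (2 * L) ^ 2 *
    rising (2 * ν + (2 * L : ℕ)) (2 * L) ^ 2) * _ * _ = _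
  generalize (∑' i : ℕ, (-w ^ 2) ^ i / (i.factorial * rising (ν + 1) (2 * L + i))) = A
  generalize (∑' j : ℕ, rising (1 / 2) (L + j) / rising (2 * ν + 5 / 2) (L + j) /
    rising (ν + 1) (2 * L + j) * ((-w ^ 2) ^ j / j.factorial)) = B
  -- Duplication of `(2ν)_{4L} = (2ν)_{2L} (2ν + 2L)_{2L}`; squared, its factor `4^(2L)` absorbs the
  -- `2^(8L)` of `e3`.
  have e1 := rising_two_mul ν (2 * L)
  rw [two_mul (2 * L), rising_add] at e1
  have e2 : rising ν (2 * L) * (ν + 2 * L) = ν * rising (ν + 1) (2 * L) := by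
    have h := rising_add ν 1 (2 * L)
    rw [add_comm 1, rising_succ, rising_succ, rising_zero] at h
    push_cast at h
    linear_combination h
  have e3 : (2 : ℂ) ^ (6 * (L : ℂ) - 3 * ν) * 2 ^ (2 * (L : ℂ) - ν) = 2 ^ (8 * L) * 2 ^ (-4 * ν) := by
    rw [← Complex.cpow_natCast, ← Complex.cpow_add _ _ two_ne_zero,
      ← Complex.cpow_add _ _ two_ne_zero]
    congr 1; push_cast; ring
  -- The exponents add up to `4L`, so the branch of the power disappears.
  have e4 : w ^ (2 * (L : ℂ) - ν) * w ^ (2 * (L : ℂ) + ν) = (-w ^ 2) ^ (2 * L) := by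
    rw [← Complex.cpow_add _ _ hw, pow_mul (-w ^ 2), neg_sq, ← pow_mul, ← pow_mul,
      ← Complex.cpow_natCast]
    congr 1; push_cast; ring
  have e5 : (2 : ℂ) ^ (8 * L) = (4 ^ (2 * L)) ^ 2 := by
    rw [show (4 : ℂ) = 2 ^ 2 by norm_num, ← pow_mul, ← pow_mul]; congr 1; ring
  have n1 := rising_ne_zero hν (2 * L)
  have n2 := rising_ne_zero hν0 (2 * L)
  have n3 := rising_ne_zero hνh (2 * L)
  have n4 := rising_ne_zero hc L
  have n5 := rising_ne_zero half_add_natCast_ne_zero L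
  have n6 := Gamma_ne_zero_of_add_natCast hν1
  have n7 := Gamma_ne_zero_of_add_natCast hc
  have n8 : Complex.Gamma (1 / 2) ≠ 0 := Gamma_ne_zero_of_add_natCast half_add_natCast_ne_zero
  have n9 : ν + 2 * L ≠ 0 := by exact_mod_cast hν0 (2 * L)
  have n10 : ν ≠ 0 := by simpa using hν0 0
  have n11 : ((2 * L).factorial : ℂ) ≠ 0 := by exact_mod_cast (2 * L).factorial_ne_zero
  have n12 : (4 : ℂ) ^ (2 * L) ≠ 0 := pow_ne_zero _ (by norm_num)
  rw [e5] at e3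
  have n13 : (2 : ℂ) ^ (2 * (L : ℂ) - ν) ≠ 0 := by simp [Complex.cpow_eq_zero_iff]
  have n14 : w ^ (2 * (L : ℂ) + ν) ≠ 0 := by simp [Complex.cpow_eq_zero_iff, hw]
  have e6 : (2 * (L : ℂ) + ν) = ν + 2 * L := add_comm _ _
  generalize (2 : ℂ) ^ (6 * (L : ℂ) - 3 * ν) = X at *
  generalize (2 : ℂ) ^ (2 * (L : ℂ) - ν) = Y at *
  generalize (2 : ℂ) ^ (-4 * ν) = P at *
  generalize w ^ (2 * (L : ℂ) - ν) = u at *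
  generalize w ^ (2 * (L : ℂ) + ν) = v at *
  generalize (-w ^ 2) ^ (2 * L) = Z at *
  generalize rising (2 * ν + (2 * L : ℕ)) (2 * L) = t at *
  generalize rising (ν + 1) (2 * L) = r at *
  generalize rising (2 * ν) (2 * L) = s at *
  generalize rising ν (2 * L) = a at *
  generalize rising (ν + 1 / 2) (2 * L) = b at *
  generalize rising (2 * ν + 5 / 2) L = cL at *
  generalize rising (1 / 2) L = h at *
  generalize Complex.Gamma (ν + 1) = G1 at *
  generalize Complex.Gamma (2 * ν) = G2 at *
  generalize Complex.Gamma (2 * ν + 5 / 2) = G3 at *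
  generalize Complex.Gamma (1 / 2) = G4 at *
  generalize (4 : ℂ) ^ (2 * L) = D at *
  generalize ((2 * L).factorial : ℂ) = f at *
  rw [e6]
  generalize ν + 2 * (L : ℂ) = m at *
  obtain rfl : t = D * a * b / s := by rw [eq_div_iff n1, mul_comm, e1]
  obtain rfl : X = D ^ 2 * P / Y := by rw [eq_div_iff n13, e3]
  obtain rfl : u = Z / v := by rw [eq_div_iff n14, e4]
  obtain rfl : r = a * m / ν := by rw [eq_div_iff n10, mul_comm, ← e2]
  field_simp

/-! ### The constant, and the theorem. -/

theorem bessel_prefactor_mul {ν : ℂ} (hν : ∀ n : ℕ, 2 * ν + n ≠ 0)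
    (hc : ∀ n : ℕ, 2 * ν + 5 / 2 + n ≠ 0) :
    (2 : ℂ) ^ (2 * ν + 1) * Complex.Gamma (ν + 1) * Complex.Gamma (2 * ν + 5 / 2) /
        (Complex.Gamma (ν + 1 / 2) * Complex.Gamma ν ^ 2) *
      ((2 : ℂ) ^ (-4 * ν) * Complex.Gamma (2 * ν) * Complex.Gamma (1 / 2) /
        (Complex.Gamma (2 * ν + 5 / 2) * ν ^ 2)) = 1 / ν := by
  have hν0 : ∀ n : ℕ, ν + n ≠ 0 := fun n h => hν (2 * n) (by push_cast; linear_combination 2 * h)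
  have hνh : ∀ n : ℕ, ν + 1 / 2 + n ≠ 0 := fun n h =>
    hν (2 * n + 1) (by push_cast; linear_combination 2 * h)
  have hν' : ν ≠ 0 := by simpa using hν0 0
  have e1 := Complex.Gamma_mul_Gamma_add_half ν
  -- The same formula at `1/2` gives `Γ(1/2) = √π`, which removes `√π` from `e1`.
  have e2 := Complex.Gamma_mul_Gamma_add_half (1 / 2)
  norm_num at e2
  rw [← e2] at e1
  have e3 : (2 : ℂ) ^ (2 * ν + 1) * 2 ^ (-4 * ν) = 2 ^ (1 - 2 * ν) := by
    rw [← Complex.cpow_add _ _ two_ne_zero]; congr 1; ring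
  have n1 := Gamma_ne_zero_of_add_natCast hν0
  have n2 := Gamma_ne_zero_of_add_natCast hνh
  have n3 := Gamma_ne_zero_of_add_natCast hc
  rw [Complex.Gamma_add_one ν hν']
  generalize Complex.Gamma (2 * ν + 5 / 2) = a at *
  generalize Complex.Gamma (ν + 1 / 2) = b at *
  generalize Complex.Gamma ν = d at *
  generalize (2 : ℂ) ^ (-4 * ν) = p at *
  field_simp
  linear_combination Complex.Gamma (2 * ν) * Complex.Gamma (1 / 2) * e3 - e1

theorem mainTheorem11 (μ k : ℂ) (hk : k ≠ 0)
    (hμ : ∀ n : ℕ, μ ≠ -((n : ℂ) + 1)) (hμ' : ∀ n : ℕ, μ ≠ 3 / 2 - (n : ℂ)) :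
    Summable (besselHypergeometricTerm μ k) ∧
    hypergeometric1F2 (μ / 2 + 3 / 4) (μ + 1 / 2) (μ + 1) (-k ^ 2) =
      (2 : ℂ) ^ (μ - 1 / 2) * Complex.Gamma (μ / 2 + 1 / 4) * Complex.Gamma (μ + 1)
        / (Complex.Gamma (μ / 2 - 1 / 4) * Complex.Gamma (μ / 2 - 3 / 4) ^ 2)
      * ∑' L : ℕ, besselHypergeometricTerm μ k L := by
  obtain ⟨ν, rfl⟩ : ∃ ν, μ = 2 * ν + 3 / 2 := ⟨(μ - 3 / 2) / 2, by ring⟩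
  obtain ⟨w, rfl⟩ : ∃ w, k = 2 * w := ⟨k / 2, by ring⟩
  have hw : w ≠ 0 := right_ne_zero_of_mul hk
  -- The two excluded sets say exactly that `2ν = μ - 3/2` and `2ν + 5/2 = μ + 1` avoid the
  -- nonpositive integers.
  have hν : ∀ n : ℕ, 2 * ν + n ≠ 0 := fun n h => hμ' n (by linear_combination h)
  have hc : ∀ n : ℕ, 2 * ν + 5 / 2 + n ≠ 0 := fun n h => hμ n (by linear_combination h)
  have hν0 : ∀ n : ℕ, ν + n ≠ 0 := fun n h => hν (2 * n) (by push_cast; linear_combination 2 * h)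
  have hν1 : ∀ n : ℕ, ν + 1 + n ≠ 0 := fun n h =>
    hν0 (n + 1) (by push_cast; linear_combination h)
  have hν2 : ∀ n : ℕ, 2 * ν + 1 + n ≠ 0 := fun n h =>
    hν (n + 1) (by push_cast; linear_combination h)
  have hsum := summable_tripleTerm hν1 hc (-w ^ 2)
  have hterm : besselHypergeometricTerm (2 * ν + 3 / 2) (2 * w) = fun L =>
      (2 : ℂ) ^ (-4 * ν) * Complex.Gamma (2 * ν) * Complex.Gamma (1 / 2) /
        (Complex.Gamma (2 * ν + 5 / 2) * ν ^ 2) *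
        ∑' y : ℕ × ℕ, tripleTerm ν (2 * ν + 5 / 2) (-w ^ 2) (L, y) := by
    funext L
    rw [besselHypergeometricTerm_eq hν hc hw, (hsum.prod_factor L).tsum_prod]
    simp only [tripleTerm, tsum_mul_left, tsum_mul_right]
  refine ⟨by rw [hterm]; exact hsum.prod.mul_left _, ?_⟩
  have key := (hasSum_tripleTerm hν0 hν2 hc (-w ^ 2)).tsum_eq
  rw [tsum_mul_left, hsum.tsum_prod] at key
  have hF : hypergeometric1F2 (ν + 3 / 2) (2 * ν + 2) (2 * ν + 5 / 2) (4 * -w ^ 2) =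
      1 / ν * ∑' (L : ℕ) (y : ℕ × ℕ), tripleTerm ν (2 * ν + 5 / 2) (-w ^ 2) (L, y) := by
    have hν' : ν ≠ 0 := by simpa using hν0 0
    rw [← key, one_div, inv_mul_cancel_left₀ hν']
    rfl
  rw [hterm, tsum_mul_left, ← mul_assoc,
    show 2 * ν + 3 / 2 - 1 / 2 = 2 * ν + 1 by ring,
    show (2 * ν + 3 / 2) / 2 + 1 / 4 = ν + 1 by ring,
    show (2 * ν + 3 / 2) / 2 - 1 / 4 = ν + 1 / 2 by ring,
    show (2 * ν + 3 / 2) / 2 - 3 / 4 = ν by ring,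
    show (2 * ν + 3 / 2) / 2 + 3 / 4 = ν + 3 / 2 by ring,
    show 2 * ν + 3 / 2 + 1 / 2 = 2 * ν + 2 by ring,
    show 2 * ν + 3 / 2 + 1 = 2 * ν + 5 / 2 by ring, bessel_prefactor_mul hν hc, ← hF]
  congr 1
  ring
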